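/- Let $s_A, s_B, s_C \in (0,1)$ be real numbers with $s_C > s_A - s_B \ge 0$. Then there exist Borel sets $A, B, C \subset \mathbb{R}$ with Hausdorff dimensions $\dim_{\mathcal H} A = s_A$, $\dim_{\mathcal H} B = s_B$, $\dim_{\mathcal H} C = s_C$ such that, for every $c \in C$, $$\dim_{\mathcal H}(A + cB) \le \min\left\{\frac{s_A+s_B+s_C}{2},\ s_A+s_B,\ 1\right\},$$ where $A + cB = \{a + cb : a \in A,\ b \in B\}$. -/

import Mathlib

open scoped Pointwise

/-!
Choose integers `M k`, `N k`, `Q k` of the orders `k ^ (sA - sB)`, `k ^ sB` and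
`k ^ ((sC - (sA - sB)) / 2)`, and let `A`, `B`, `C` consist of the points of `[0, 1]` which, for
every `k` in a rapidly increasing sequence, lie within `1 / k` of, respectively,
* the grid of the multiples of `1 / (M k * N k)`,
* the grid of the multiples of `1 / N k`,
* the fractions `p / (q * M k)` with `1 ≤ q ≤ Q k`.

These sets have about `k ^ sA`, `k ^ sB` and `k ^ sC` points per unit length with comparable gaps,
the fractions by Dirichlet's theorem. Covering by the intervals of one scale bounds the
dimensions from above, the natural measure on the tree of these intervals from below.

If `c` is near `p / (q * M k)`, then `A + c • B` is near the multiples of `1 / (q * M k * N k)`,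
whence its dimension is at most that of a grid with `M k * N k * Q k` points per unit length. The
order of this number is `k ^ ((sA + sB + sC) / 2)`.
-/

open Asymptotics Filter MeasureTheory Metric Set
open scoped ENNReal Finset NNReal Topology

/-! ### Covering numbers along a sequence of scales -/

/-- At the scales `1 / n j`, all but finitely many of the covering numbers of `S` are `O(n j ^ t)`:
the box dimension of `S` along these scales is at most `t`. -/
def CoveredAtScales {X : Type*} [PseudoMetricSpace X] (n : ℕ → ℕ) (t : ℝ) (S : Set X) : Prop :=
  ∃ C ≥ (0 : ℝ), ∃ ρ ≥ (0 : ℝ), ∀ᶠ j in atTop, ∃ F : Finset X,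
    (#F : ℝ) ≤ C * n j ^ t ∧ S ⊆ ⋃ y ∈ F, closedBall y (ρ / n j)

namespace CoveredAtScales

theorem dimH_le {X : Type*} [MetricSpace X] {n : ℕ → ℕ} {t : ℝ} {S : Set X}
    (h : CoveredAtScales n t S) (hn : Tendsto n atTop atTop) (ht : 0 ≤ t) :
    dimH S ≤ ENNReal.ofReal t := by
  borelize X
  obtain ⟨C, -, ρ, hρ, h⟩ := h
  obtain ⟨J, hJ⟩ := eventually_atTop.1 (h.and (hn.eventually_gt_atTop 0))
  have hpos (i : ℕ) : (0 : ℝ) < n (J + i) := Nat.cast_pos.2 (hJ _ (J.le_add_right i)).2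
  choose F hF hS using fun i ↦ (hJ (J + i) (J.le_add_right i)).1
  have hdiam (i : ℕ) (y : F i) :
      ediam (closedBall (y : X) (ρ / n (J + i))) ≤ ENNReal.ofReal (2 * ρ / n (J + i)) := by
    rw [← ENNReal.ofReal_toReal isBounded_closedBall.ediam_ne_top, mul_div_assoc]
    exact ENNReal.ofReal_le_ofReal (diam_closedBall (by positivity))
  have hlim : Tendsto (fun i ↦ ENNReal.ofReal (2 * ρ / n (J + i))) atTop (𝓝 0) := by
    have hn' : Tendsto (fun i ↦ (n (J + i) : ℝ)) atTop atTop :=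
      tendsto_natCast_atTop_atTop.comp (hn.comp (tendsto_add_atTop_nat J |>.congr (add_comm · J)))
    simpa using ENNReal.tendsto_ofReal (hn'.const_div_atTop (2 * ρ))
  have hsum (i : ℕ) : ∑ y : F i, ediam (closedBall (y : X) (ρ / n (J + i))) ^ t ≤
      ENNReal.ofReal (C * (2 * ρ) ^ t) :=
    calc ∑ y : F i, ediam (closedBall (y : X) (ρ / n (J + i))) ^ t
        ≤ ∑ _y : F i, ENNReal.ofReal (2 * ρ / n (J + i)) ^ t :=
          Finset.sum_le_sum fun y _ ↦ ENNReal.rpow_le_rpow (hdiam i y) ht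
      _ = ENNReal.ofReal (#(F i) * (2 * ρ / n (J + i)) ^ t) := by
          rw [Finset.sum_const, Finset.card_univ, Fintype.card_coe, nsmul_eq_mul,
            ENNReal.ofReal_rpow_of_nonneg (by positivity) ht, ENNReal.ofReal_mul (by positivity),
            ENNReal.ofReal_natCast]
      _ ≤ ENNReal.ofReal (C * (2 * ρ) ^ t) := by
          refine ENNReal.ofReal_le_ofReal ?_
          rw [Real.div_rpow (by positivity) (by positivity), mul_div_assoc',
            div_le_iff₀ (Real.rpow_pos_of_pos (hpos i) t), mul_right_comm]
          exact mul_le_mul_of_nonneg_right (hF i) (by positivity)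
  have hμ : μH[t] S ≤ ENNReal.ofReal (C * (2 * ρ) ^ t) :=
    (Measure.hausdorffMeasure_le_liminf_sum (ι := fun i ↦ F i) t S _ hlim _
      (.of_forall hdiam) (.of_forall fun i ↦ by simpa [iUnion_subtype] using hS i)).trans <|
      (liminf_le_liminf (.of_forall hsum)).trans_eq (liminf_const _)
  exact dimH_le_of_hausdorffMeasure_ne_top (d := t.toNNReal)
    (by rw [Real.coe_toNNReal _ ht]; exact (hμ.trans_lt ENNReal.ofReal_lt_top).ne)

theorem add {E : Type*} [SeminormedAddCommGroup E] {n : ℕ → ℕ} {t u : ℝ} {S T : Set E}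
    (hS : CoveredAtScales n t S) (hT : CoveredAtScales n u T) (hn : Tendsto n atTop atTop) :
    CoveredAtScales n (t + u) (S + T) := by
  classical
  obtain ⟨C, hC, ρ, hρ, hS⟩ := hS
  obtain ⟨C', hC', ρ', hρ', hT⟩ := hT
  refine ⟨C * C', by positivity, ρ + ρ', by positivity, ?_⟩
  filter_upwards [hS, hT, hn.eventually_gt_atTop 0] with j ⟨F, hF, hSF⟩ ⟨G, hG, hTG⟩ hj
  refine ⟨F + G, ?_, ?_⟩
  · calc (#(F + G) : ℝ) ≤ #F * #G := by exact_mod_cast Finset.card_add_le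
      _ ≤ (C * n j ^ t) * (C' * n j ^ u) := by gcongr
      _ = C * C' * n j ^ (t + u) := by rw [Real.rpow_add (Nat.cast_pos.2 hj)]; ring
  · rintro _ ⟨x, hx, y, hy, rfl⟩
    obtain ⟨x', hx', hxx'⟩ := mem_iUnion₂.1 (hSF hx)
    obtain ⟨y', hy', hyy'⟩ := mem_iUnion₂.1 (hTG hy)
    refine mem_iUnion₂.2 ⟨x' + y', Finset.add_mem_add hx' hy', (dist_add_add_le ..).trans ?_⟩
    rw [add_div]
    exact add_le_add hxx' hyy'

theorem image {X Y : Type*} [PseudoMetricSpace X] [PseudoMetricSpace Y] {n : ℕ → ℕ} {t : ℝ}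
    {S : Set X} {f : X → Y} {K : ℝ≥0} (hS : CoveredAtScales n t S) (hf : LipschitzWith K f) :
    CoveredAtScales n t (f '' S) := by
  classical
  obtain ⟨C, hC, ρ, hρ, hS⟩ := hS
  refine ⟨C, hC, K * ρ, by positivity, hS.mono fun j ⟨F, hF, hSF⟩ ↦ ⟨F.image f, ?_, ?_⟩⟩
  · exact (Nat.cast_le.2 Finset.card_image_le).trans hF
  · rintro _ ⟨x, hx, rfl⟩
    obtain ⟨y, hy, hxy⟩ := mem_iUnion₂.1 (hSF hx)
    refine mem_iUnion₂.2 ⟨f y, Finset.mem_image_of_mem f hy, ?_⟩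
    rw [mul_div_assoc]
    exact hf.dist_le_mul_of_le hxy

theorem dimH_add_smul_le {𝕜 E : Type*} [NormedField 𝕜] [NormedAddCommGroup E] [NormedSpace 𝕜 E]
    {n : ℕ → ℕ} {t u : ℝ} {S T : Set E} (hS : CoveredAtScales n t S) (hT : CoveredAtScales n u T)
    (hn : Tendsto n atTop atTop) (htu : 0 ≤ t + u) (c : 𝕜) :
    dimH (S + c • T) ≤ ENNReal.ofReal (t + u) :=
  (hS.add (hT.image (lipschitzWith_smul c)) hn).dimH_le hn htu

end CoveredAtScales

theorem dimH_real_le_ofReal_min {S : Set ℝ} {t u : ℝ} (ht : dimH S ≤ ENNReal.ofReal t)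
    (hu : dimH S ≤ ENNReal.ofReal u) : dimH S ≤ ENNReal.ofReal (min t (min u 1)) := by
  rw [ENNReal.ofReal_mono.map_min, ENNReal.ofReal_mono.map_min, ENNReal.ofReal_one,
    ← Real.dimH_univ]
  exact le_min ht (le_min hu (dimH_mono (subset_univ S)))

theorem finite_and_ncard_le_of_pairwise_le_dist {S : Set ℝ} {a b d : ℝ} (hd : 0 < d) (hab : a ≤ b)
    (hS : S ⊆ Icc a b) (hsep : S.Pairwise (d ≤ dist · ·)) :
    S.Finite ∧ (S.ncard : ℝ) ≤ 1 + (b - a) / d := by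
  let N := ⌊(b - a) / d⌋₊
  have hmaps : MapsTo (fun x ↦ ⌊(x - a) / d⌋₊) S (Finset.range (N + 1)) := fun x hx ↦ by
    rw [Finset.mem_coe, Finset.mem_range_succ_iff]
    have := (hS hx).2
    dsimp only [N]
    gcongr
  have hinj : InjOn (fun x ↦ ⌊(x - a) / d⌋₊) S := fun x hx y hy hxy ↦ by
    by_contra hne
    have hx0 : 0 ≤ (x - a) / d := div_nonneg (sub_nonneg.2 (hS hx).1) hd.le
    have hy0 : 0 ≤ (y - a) / d := div_nonneg (sub_nonneg.2 (hS hy).1) hd.le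
    have hlt : |(x - a) / d - (y - a) / d| < 1 := Int.abs_sub_lt_one_of_floor_eq_floor <| by
      rw [← Int.natCast_floor_eq_floor hx0, ← Int.natCast_floor_eq_floor hy0]
      exact congrArg _ hxy
    rw [← sub_div, sub_sub_sub_cancel_right, abs_div, abs_of_pos hd, div_lt_one hd] at hlt
    exact hlt.not_ge (hsep hx hy hne)
  refine ⟨Finite.of_injOn hmaps hinj (Finset.finite_toSet _), ?_⟩
  calc (S.ncard : ℝ) ≤ N + 1 := by
        have := ncard_le_ncard_of_injOn _ hmaps hinj
        rw [ncard_coe_finset, Finset.card_range] at this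
        exact_mod_cast this
    _ ≤ 1 + (b - a) / d := by
        rw [add_comm]
        exact add_le_add_right (Nat.floor_le (div_nonneg (sub_nonneg.2 hab) hd.le)) 1

theorem coveredAtScales_of_separated {S : Set ℝ} {n : ℕ → ℕ} {t C D : ℝ}
    (hn : Tendsto n atTop atTop) (ht : 0 ≤ t) (hC : 0 < C) (hS : Bornology.IsBounded S)
    (hnear : ∀ᶠ j in atTop, ∃ E : Set ℝ,
      E.Pairwise ((C * n j ^ t)⁻¹ ≤ dist · ·) ∧ S ⊆ thickening (D / n j) E) :
    CoveredAtScales n t S := by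
  obtain ⟨R, hR, hSR⟩ := hS.subset_closedBall_lt 0 0
  refine ⟨1 + 2 * (R + |D|) * C, by positivity, |D|, abs_nonneg D, ?_⟩
  filter_upwards [hnear, hn.eventually_gt_atTop 0] with j ⟨E, hsep, hnear⟩ hj
  have hj1 : (1 : ℝ) ≤ n j := Nat.one_le_cast.2 hj
  have hjt : 1 ≤ (n j : ℝ) ^ t := Real.one_le_rpow hj1 ht
  obtain ⟨hfin, hcard⟩ := finite_and_ncard_le_of_pairwise_le_dist (d := (C * n j ^ t)⁻¹)
    (by positivity) (by linarith [abs_nonneg D] : -(R + |D|) ≤ R + |D|) inter_subset_right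
    (hsep.mono (inter_subset_left (t := Icc (-(R + |D|)) (R + |D|))))
  refine ⟨hfin.toFinset, ?_, fun x hx ↦ ?_⟩
  · rw [← ncard_eq_toFinset_card _ hfin]
    refine hcard.trans ?_
    rw [div_inv_eq_mul]
    nlinarith
  · obtain ⟨y, hy, hxy⟩ := mem_thickening_iff.1 (hnear hx)
    have hDj : D / n j ≤ |D| / n j := by gcongr; exact le_abs_self D
    have hDD : |D| / n j ≤ |D| := div_le_self (abs_nonneg D) hj1
    have hxR : |x| ≤ R := by simpa using hSR hx
    have hyR : |y| ≤ R + |D| := by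
      rw [Real.dist_eq] at hxy
      linarith [abs_sub_abs_le_abs_sub y x, abs_sub_comm x y]
    exact mem_iUnion₂.2 ⟨y, hfin.mem_toFinset.2 ⟨hy, abs_le.1 hyR⟩, hxy.le.trans hDj⟩

/-! ### Mass distribution on trees of intervals -/

theorem le_dimH_of_measure_closedBall_le {X : Type*} [MetricSpace X] [MeasurableSpace X]
    [BorelSpace X] {S : Set X} {μ : Measure X} (hS : μ S ≠ 0) {t : ℝ≥0} {C ρ : ℝ} (hC : 0 < C)
    (hρ : 0 < ρ)
    (h : ∀ x r, 0 < r → r < ρ → μ (closedBall x r) ≤ ENNReal.ofReal (C * r ^ (t : ℝ))) :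
    t ≤ dimH S := by
  have hbound (U : Set X) (hU : ediam U ≤ ENNReal.ofReal (ρ / 2)) :
      μ U ≤ ENNReal.ofReal C * ediam U ^ (t : ℝ) := by
    rcases U.eq_empty_or_nonempty with rfl | ⟨x, hx⟩
    · simp
    have hfin : ediam U ≠ ∞ := (hU.trans_lt ENNReal.ofReal_lt_top).ne
    have hdiam : diam U < ρ :=
      (ENNReal.toReal_le_of_le_ofReal (half_pos hρ).le hU).trans_lt (half_lt_self hρ)
    have hlim : Tendsto (fun r : ℝ ↦ ENNReal.ofReal (C * r ^ (t : ℝ))) (𝓝[>] diam U)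
        (𝓝 (ENNReal.ofReal (C * diam U ^ (t : ℝ)))) :=
      ENNReal.tendsto_ofReal <| (((Real.continuous_rpow_const t.2).tendsto _).const_mul C).mono_left
        nhdsWithin_le_nhds
    calc μ U ≤ ENNReal.ofReal (C * diam U ^ (t : ℝ)) := by
          refine ge_of_tendsto hlim ?_
          filter_upwards [Ioo_mem_nhdsGT hdiam] with r ⟨hUr, hrρ⟩
          refine (measure_mono fun y hy ↦ ?_).trans (h x r (diam_nonneg.trans_lt hUr) hrρ)
          exact (dist_le_diam_of_mem (isBounded_iff_ediam_ne_top.2 hfin) hy hx).trans hUr.le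
      _ = ENNReal.ofReal C * ediam U ^ (t : ℝ) := by
          rw [ENNReal.ofReal_mul hC.le, ← ENNReal.ofReal_rpow_of_nonneg diam_nonneg t.coe_nonneg,
            diam, ENNReal.ofReal_toReal hfin]
  have hC' : ENNReal.ofReal C ≠ 0 := by simpa using hC
  have hle : (ENNReal.ofReal C)⁻¹ • μ ≤ μH[t] :=
    Measure.le_hausdorffMeasure _ _ (ENNReal.ofReal (ρ / 2)) (by simpa using hρ) fun U hU ↦ by
      rw [Measure.smul_apply, smul_eq_mul, ENNReal.inv_mul_le_iff hC' ENNReal.ofReal_ne_top]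
      exact hbound U hU
  refine le_dimH_of_hausdorffMeasure_ne_zero fun h0 ↦ hS ?_
  simpa [h0] using hle S

theorem exists_succ_le_and_lt {δ : ℕ → ℝ} (hδ : Tendsto δ atTop (𝓝 0)) {N : ℕ} {r : ℝ} (hr : 0 < r)
    (hrN : r < δ N) : ∃ n ≥ N, δ (n + 1) ≤ r ∧ r < δ n := by
  by_contra! h
  have hlt : ∀ n ≥ N, r < δ n := fun n hn ↦
    Nat.le_induction hrN (fun k hk ih ↦ not_le.1 fun hle ↦ (h k hk hle).not_gt ih) n hn
  obtain ⟨n, hn, hnr⟩ := ((eventually_ge_atTop N).and (hδ.eventually_lt_const hr)).exists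
  exact (hlt n hn).not_gt hnr

theorem div_mul_rpow_le_rpow {x y t : ℝ} (hx : 0 < x) (hxy : x ≤ y) (ht : t ≤ 1) :
    x / y * y ^ t ≤ x ^ t :=
  calc x / y * y ^ t = x * y ^ (t - 1) := by
        rw [Real.rpow_sub_one (hx.trans_le hxy).ne']; ring
    _ ≤ x * x ^ (t - 1) := by
        gcongr ?_ * ?_
        exact Real.rpow_le_rpow_of_nonpos hx hxy (sub_nonpos.2 ht)
    _ = x ^ t := by rw [Real.rpow_sub_one hx.ne', mul_div_cancel₀ _ hx.ne']

/-- The left endpoints along the branch `ω` of a tree of nested intervals, where `e n y j` is the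
left endpoint of the `j`-th child of an interval of generation `n` with left endpoint `y`. -/
noncomputable def branchPoint {m : ℕ → ℕ} (e : ∀ n, ℝ → Fin (m n) → ℝ) (ω : ∀ n, Fin (m n)) :
    ℕ → ℝ
  | 0 => 0
  | n + 1 => e n (branchPoint e ω n) (ω n)

/-- The point of the line to which the intervals along the branch `ω` of a tree shrink. -/
noncomputable def branchLimit {m : ℕ → ℕ} (e : ∀ n, ℝ → Fin (m n) → ℝ) (ω : ∀ n, Fin (m n)) : ℝ :=
  ⨆ n, branchPoint e ω n

/-- The law of a branch whose steps are chosen independently and uniformly: the natural measure on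
the boundary of a tree. -/
noncomputable def branchMeasure (m : ℕ → ℕ) [∀ n, NeZero (m n)] : Measure (∀ n, Fin (m n)) :=
  Measure.infinitePi fun n ↦ (PMF.uniformOfFintype (Fin (m n))).toMeasure

instance (m : ℕ → ℕ) [∀ n, NeZero (m n)] : IsProbabilityMeasure (branchMeasure m) := by
  unfold branchMeasure; infer_instance

/-- A tree of nested intervals, those of generation `n` having length `δ n`, in which the left
endpoints of distinct intervals of generation `n + 1` are at least `d n` apart. -/
structure IsBranching {m : ℕ → ℕ} (e : ∀ n, ℝ → Fin (m n) → ℝ) (δ d : ℕ → ℝ) : Prop where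
  length_pos : ∀ n, 0 < δ n
  le : ∀ n y j, y ≤ e n y j
  add_le : ∀ n y j, e n y j + δ (n + 1) ≤ y + δ n
  separated : ∀ n y y' j j', e n y j ≠ e n y' j' → d n ≤ dist (e n y j) (e n y' j')
  injective : ∀ n y, Function.Injective (e n y)
  three_mul_length_le : ∀ n, 3 * δ (n + 1) ≤ d n

section Branching

variable {m : ℕ → ℕ} {e : ∀ n, ℝ → Fin (m n) → ℝ} {δ d : ℕ → ℝ}

theorem measurableSet_branchPoint_mem (e : ∀ n, ℝ → Fin (m n) → ℝ) (n : ℕ) (S : Set ℝ) :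
    MeasurableSet {ω | branchPoint e ω n ∈ S} := by
  induction n generalizing S with
  | zero => simp only [branchPoint, MeasurableSet.const]
  | succ n ih =>
    have : {ω | branchPoint e ω (n + 1) ∈ S} =
        ⋃ j : Fin (m n), {ω | ω n = j} ∩ {ω | branchPoint e ω n ∈ {y | e n y j ∈ S}} := by
      ext ω
      simp [branchPoint]
    rw [this]
    exact .iUnion fun j ↦ (measurableSet_eq_fun (measurable_pi_apply n) measurable_const).inter
      (ih _)

theorem measurable_branchLimit (e : ∀ n, ℝ → Fin (m n) → ℝ) : Measurable (branchLimit e) :=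
  Measurable.iSup fun n S _ ↦ measurableSet_branchPoint_mem e n S

theorem branchMeasure_cylinder [∀ n, NeZero (m n)] (n : ℕ) (v : ∀ n, Fin (m n)) :
    branchMeasure m {ω | ∀ i < n, ω i = v i} =
      ENNReal.ofReal (∏ i ∈ Finset.range n, (m i : ℝ)⁻¹) := by
  have h : {ω : ∀ n, Fin (m n) | ∀ i < n, ω i = v i} =
      Set.pi (Finset.range n : Set ℕ) fun i ↦ {v i} := by
    ext ω; simp [Set.mem_pi]
  rw [h, branchMeasure, Measure.infinitePi_pi _ (fun i _ ↦ measurableSet_singleton _),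
    ENNReal.ofReal_prod_of_nonneg (fun i _ ↦ by positivity)]
  refine Finset.prod_congr rfl fun i _ ↦ ?_
  rw [PMF.toMeasure_apply_singleton _ _ (measurableSet_singleton _),
    PMF.uniformOfFintype_apply, Fintype.card_fin,
    ENNReal.ofReal_inv_of_pos (Nat.cast_pos.2 (NeZero.pos _)), ENNReal.ofReal_natCast]

namespace IsBranching

theorem gap_pos (h : IsBranching e δ d) (n : ℕ) : 0 < d n :=
  (mul_pos three_pos (h.length_pos _)).trans_le (h.three_mul_length_le n)

theorem branchPoint_mono (h : IsBranching e δ d) (ω : ∀ n, Fin (m n)) :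
    Monotone (branchPoint e ω) :=
  monotone_nat_of_le_succ fun n ↦ h.le n _ _

theorem antitone_branchPoint_add (h : IsBranching e δ d) (ω : ∀ n, Fin (m n)) :
    Antitone fun n ↦ branchPoint e ω n + δ n :=
  antitone_nat_of_succ_le fun n ↦ h.add_le n _ _

theorem branchPoint_mem_Icc (h : IsBranching e δ d) (ω : ∀ n, Fin (m n)) {n k : ℕ} (hn : n ≤ k) :
    branchPoint e ω k ∈ Icc (branchPoint e ω n) (branchPoint e ω n + δ n) :=
  ⟨h.branchPoint_mono ω hn,
    (le_add_of_nonneg_right (h.length_pos k).le).trans (h.antitone_branchPoint_add ω hn)⟩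

theorem branchLimit_mem_Icc (h : IsBranching e δ d) (ω : ∀ n, Fin (m n)) (n : ℕ) :
    branchLimit e ω ∈ Icc (branchPoint e ω n) (branchPoint e ω n + δ n) := by
  have hle (k : ℕ) : branchPoint e ω k ≤ branchPoint e ω n + δ n :=
    (h.branchPoint_mono ω (le_max_right n k)).trans
      (h.branchPoint_mem_Icc ω (le_max_left n k)).2
  exact ⟨le_ciSup ⟨_, forall_mem_range.2 hle⟩ n, ciSup_le hle⟩

theorem branchPoint_eq_of_dist_lt (h : IsBranching e δ d) {ω ω' : ∀ n, Fin (m n)} {n : ℕ}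
    {x x' : ℝ} (hx : x ∈ Icc (branchPoint e ω n) (branchPoint e ω n + δ n))
    (hx' : x' ∈ Icc (branchPoint e ω' n) (branchPoint e ω' n + δ n))
    (hxx' : dist x x' < 2 * δ n) : branchPoint e ω n = branchPoint e ω' n := by
  cases n with
  | zero => rfl
  | succ n =>
    by_contra hne
    have hgap := (h.three_mul_length_le n).trans (h.separated n _ _ _ _ hne)
    rw [Real.dist_eq, abs_lt] at hxx'
    refine hgap.not_gt (abs_lt.2 ⟨?_, ?_⟩) <;>
      simp only [branchPoint, mem_Icc] at hx hx' ⊢ <;> linarith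

theorem eq_of_branchPoint_eq (h : IsBranching e δ d) {ω ω' : ∀ n, Fin (m n)} (n : ℕ)
    (hn : branchPoint e ω n = branchPoint e ω' n) : ∀ i < n, ω i = ω' i := by
  induction n with
  | zero => exact fun i hi ↦ absurd hi i.not_lt_zero
  | succ n ih =>
    have hprev : branchPoint e ω n = branchPoint e ω' n :=
      h.branchPoint_eq_of_dist_lt (h.branchPoint_mem_Icc ω n.le_succ)
        (hn ▸ h.branchPoint_mem_Icc ω' n.le_succ)
        (by rw [dist_self]; exact mul_pos two_pos (h.length_pos n))
    refine Nat.forall_lt_succ_right.2 ⟨ih hprev, h.injective n (branchPoint e ω' n) ?_⟩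
    simpa only [branchPoint, hprev] using hn

theorem ncard_le_of_image_subset_Icc (h : IsBranching e δ d) {n : ℕ} {y a b : ℝ} (hab : a ≤ b)
    {J : Set (Fin (m n))} (hJ : e n y '' J ⊆ Icc a b) : (J.ncard : ℝ) ≤ 1 + (b - a) / d n := by
  rw [← ncard_image_of_injective J (h.injective n y)]
  refine (finite_and_ncard_le_of_pairwise_le_dist (h.gap_pos n) hab hJ ?_).2
  rintro _ ⟨j, -, rfl⟩ _ ⟨j', -, rfl⟩ hne
  exact h.separated n _ _ _ _ hne

/-- Such a ball meets a single interval of generation `n`, and meets only those of its children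
whose left endpoints lie in an interval of length `3 * r`. -/
theorem branchMeasure_closedBall_le [∀ n, NeZero (m n)] (h : IsBranching e δ d) {n : ℕ} {r : ℝ}
    (hr : δ (n + 1) ≤ r) (hr' : r < δ n) (x : ℝ) :
    branchMeasure m {ω | branchLimit e ω ∈ closedBall x r} ≤
      ENNReal.ofReal ((1 + 3 * r / d n) * ∏ i ∈ Finset.range (n + 1), (m i : ℝ)⁻¹) := by
  set W : Set (∀ n, Fin (m n)) := {ω | branchLimit e ω ∈ closedBall x r}
  rcases W.eq_empty_or_nonempty with hW | ⟨v, hv⟩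
  · simp [hW]
  have hpoint : ∀ ω ∈ W, branchPoint e ω n = branchPoint e v n := fun ω hω ↦
    h.branchPoint_eq_of_dist_lt (h.branchLimit_mem_Icc ω n) (h.branchLimit_mem_Icc v n)
      ((dist_triangle_right _ _ x).trans_lt
        (by linarith [mem_closedBall.1 hω, mem_closedBall.1 hv]))
  let J : Set (Fin (m n)) := (fun ω ↦ ω n) '' W
  have hchildren : e n (branchPoint e v n) '' J ⊆ Icc (x - 2 * r) (x + r) := by
    rintro _ ⟨_, ⟨ω, hω, rfl⟩, rfl⟩
    have hlim := h.branchLimit_mem_Icc ω (n + 1)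
    have hball : branchLimit e ω ∈ closedBall x r := hω
    simp only [Real.closedBall_eq_Icc, branchPoint, hpoint ω hω, mem_Icc] at hlim hball
    constructor <;> linarith
  have hcard : (J.ncard : ℝ) ≤ 1 + 3 * r / d n :=
    (h.ncard_le_of_image_subset_Icc (by linarith [h.length_pos (n + 1)]) hchildren).trans_eq
      (by ring)
  have hcover : W ⊆ ⋃ j ∈ J.toFinite.toFinset,
      {ω | ∀ i < n + 1, ω i = Function.update v n j i} := fun ω hω ↦ by
    refine mem_iUnion₂.2 ⟨ω n, J.toFinite.mem_toFinset.2 ⟨ω, hω, rfl⟩,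
      Nat.forall_lt_succ_right.2 ⟨fun i hi ↦ ?_, by simp⟩⟩
    rw [Function.update_of_ne hi.ne]
    exact h.eq_of_branchPoint_eq n (hpoint ω hω) i hi
  calc branchMeasure m W
      ≤ ∑ j ∈ J.toFinite.toFinset,
          branchMeasure m {ω | ∀ i < n + 1, ω i = Function.update v n j i} :=
        (measure_mono hcover).trans (measure_biUnion_finset_le _ _)
    _ = ENNReal.ofReal (J.ncard * ∏ i ∈ Finset.range (n + 1), (m i : ℝ)⁻¹) := by
        simp only [branchMeasure_cylinder, Finset.sum_const, nsmul_eq_mul,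
          ← ncard_eq_toFinset_card]
        rw [ENNReal.ofReal_mul (by positivity), ENNReal.ofReal_natCast]
    _ ≤ ENNReal.ofReal ((1 + 3 * r / d n) * ∏ i ∈ Finset.range (n + 1), (m i : ℝ)⁻¹) := by
        gcongr

end IsBranching

/-- The hypothesis `hm` says that the children of an interval of generation `n` are as numerous, up
to the factor `K`, as their distances allow. -/
theorem IsBranching.le_dimH [∀ n, NeZero (m n)] (h : IsBranching e δ d)
    (hδ : Tendsto δ atTop (𝓝 0)) {K : ℝ} (hm : ∀ n, δ n ≤ K * (m n * d n)) {t : ℝ≥0} (ht : t ≤ 1)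
    (hprod : ∀ᶠ n in atTop, ∏ i ∈ Finset.range n, (m i : ℝ)⁻¹ ≤ δ n ^ (t : ℝ))
    {S : Set ℝ} (hS : ∀ ω, branchLimit e ω ∈ S) : t ≤ dimH S := by
  have hmpos (n : ℕ) : (0 : ℝ) < m n := Nat.cast_pos.2 (NeZero.pos _)
  have hK : 0 < K := pos_of_mul_pos_left ((h.length_pos 0).trans_le (hm 0))
    (mul_pos (hmpos 0) (h.gap_pos 0)).le
  obtain ⟨N, hN⟩ := eventually_atTop.1 hprod
  have hmeas := measurable_branchLimit e
  refine le_dimH_of_measure_closedBall_le (μ := (branchMeasure m).map (branchLimit e))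
    (C := 1 + 3 * K) (ρ := δ N) ?_ (by positivity) (h.length_pos N) fun x r hr hrN ↦ ?_
  · refine ((zero_lt_one.trans_eq ?_).trans_le (Measure.le_map_apply hmeas.aemeasurable S)).ne'
    rw [preimage_eq_univ_iff.2 (range_subset_iff.2 hS), measure_univ]
  obtain ⟨n, hn, hrn, hrn'⟩ := exists_succ_le_and_lt hδ hr hrN
  have hδn := h.length_pos n
  have hdn := h.gap_pos n
  rw [Measure.map_apply hmeas measurableSet_closedBall]
  refine (h.branchMeasure_closedBall_le hrn hrn' x).trans (ENNReal.ofReal_le_ofReal ?_)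
  have hsucc : ∏ i ∈ Finset.range (n + 1), (m i : ℝ)⁻¹ ≤ r ^ (t : ℝ) :=
    (hN (n + 1) (hn.trans n.le_succ)).trans (Real.rpow_le_rpow (h.length_pos _).le hrn t.2)
  have hscale := div_mul_rpow_le_rpow hr hrn'.le (NNReal.coe_le_one.2 ht)
  have hchild : (m n : ℝ)⁻¹ / d n ≤ K / δ n := by
    rw [inv_eq_one_div, div_div, div_le_div_iff₀ (mul_pos (hmpos n) hdn) hδn, one_mul]
    exact hm n
  calc (1 + 3 * r / d n) * ∏ i ∈ Finset.range (n + 1), (m i : ℝ)⁻¹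
      = ∏ i ∈ Finset.range (n + 1), (m i : ℝ)⁻¹ +
          3 * r * ((m n : ℝ)⁻¹ / d n) * ∏ i ∈ Finset.range n, (m i : ℝ)⁻¹ := by
        rw [Finset.prod_range_succ]; ring
    _ ≤ r ^ (t : ℝ) + 3 * r * (K / δ n) * δ n ^ (t : ℝ) := by gcongr; exact hN n hn
    _ = r ^ (t : ℝ) + 3 * K * (r / δ n * δ n ^ (t : ℝ)) := by ring
    _ ≤ r ^ (t : ℝ) + 3 * K * r ^ (t : ℝ) := by gcongr
    _ = (1 + 3 * K) * r ^ (t : ℝ) := by ring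

end Branching

/-! ### Sets which look like a grid at each of a sequence of scales -/

/-- The set `E N` has, up to the factor `C`, the gaps and the local cardinalities of a grid of
`N ^ s` equally spaced points per unit length. -/
structure IsSpread (E : ℕ → Set ℝ) (s C : ℝ) : Prop where
  separated : ∀ᶠ N : ℕ in atTop, (E N).Pairwise ((C * N ^ s)⁻¹ ≤ dist · ·)
  exists_finset : ∀ ℓ > 0, ∀ᶠ N : ℕ in atTop, ∀ x : ℝ, ∃ F : Finset ℝ,
    ↑F ⊆ E N ∩ Icc x (x + ℓ) ∧ ℓ * N ^ s ≤ C * #F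

/-- The points of the unit interval within `1 / n j` of the set `E (n j)` for every `j ≥ 1`. -/
def limitSet (E : ℕ → Set ℝ) (n : ℕ → ℕ) : Set ℝ :=
  Icc 0 1 ∩ ⋂ j, cthickening (n (j + 1) : ℝ)⁻¹ (E (n (j + 1)))

/-- The scale `1 / N` is so fine compared with the scale `1 / a` that every interval of length
`1 / a` can be subdivided into intervals of length `1 / N` around points of `E N`. -/
structure IsAdmissible (E : ℕ → Set ℝ) (s C : ℝ) (a N : ℕ) : Prop where
  pos : 0 < a
  two_mul_le : 2 * a ≤ N
  three_mul_le : 3 * (C * (N : ℝ) ^ s) ≤ N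
  two_mul_mul_le_rpow : 2 * C * a ≤ (N : ℝ) ^ (1 / a : ℝ)
  separated : (E N).Pairwise ((C * N ^ s)⁻¹ ≤ dist · ·)
  exists_finset : ∀ x : ℝ, ∃ F : Finset ℝ,
    ↑F ⊆ E N ∩ Icc x (x + 1 / (2 * a)) ∧ 1 / (2 * a) * (N : ℝ) ^ s ≤ C * #F

theorem isClosed_limitSet (E : ℕ → Set ℝ) (n : ℕ → ℕ) : IsClosed (limitSet E n) :=
  isClosed_Icc.inter <| isClosed_iInter fun _ ↦ isClosed_cthickening

theorem limitSet_subset_thickening {E : ℕ → Set ℝ} {n : ℕ → ℕ} {j : ℕ} (hj : 0 < n (j + 1)) :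
    limitSet E n ⊆ thickening (2 / n (j + 1)) (E (n (j + 1))) := by
  refine (inter_subset_right.trans (iInter_subset _ j)).trans
    (cthickening_subset_thickening' (by positivity) ?_ _)
  rw [inv_eq_one_div]
  gcongr
  exact one_lt_two

theorem IsSpread.eventually_isAdmissible {E : ℕ → Set ℝ} {s C : ℝ} (h : IsSpread E s C)
    (hs : s < 1) {a : ℕ} (ha : 0 < a) : ∀ᶠ N in atTop, IsAdmissible E s C a N := by
  have hrpow {u : ℝ} (hu : 0 < u) (x : ℝ) : ∀ᶠ N : ℕ in atTop, x ≤ (N : ℝ) ^ u :=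
    ((tendsto_rpow_atTop hu).comp tendsto_natCast_atTop_atTop).eventually_ge_atTop x
  filter_upwards [eventually_ge_atTop (2 * a), hrpow (sub_pos.2 hs) (3 * C),
    hrpow (one_div_pos.2 (Nat.cast_pos.2 ha)) (2 * C * a), h.separated,
    h.exists_finset (1 / (2 * a)) (by positivity)] with N hN hgap hgrowth hsep hfin
  refine ⟨ha, hN, ?_, hgrowth, hsep, hfin⟩
  have hN0 : (0 : ℝ) < N := Nat.cast_pos.2 (by omega)
  calc 3 * (C * (N : ℝ) ^ s) = 3 * C * (N : ℝ) ^ s := by ring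
    _ ≤ (N : ℝ) ^ (1 - s) * (N : ℝ) ^ s := by gcongr
    _ = N := by rw [← Real.rpow_add hN0, sub_add_cancel, Real.rpow_one]

theorem exists_seq_of_forall_eventually {p : ℕ → ℕ → Prop}
    (h : ∀ a > 0, ∀ᶠ N in atTop, p a N) : ∃ n : ℕ → ℕ, ∀ j, p (n j) (n (j + 1)) := by
  have hstep (a : {a : ℕ // 0 < a}) : ∃ N : {N : ℕ // 0 < N}, p a N :=
    let ⟨N, hN, hpos⟩ := ((h a a.2).and (eventually_gt_atTop 0)).exists
    ⟨⟨N, hpos⟩, hN⟩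
  choose f hf using hstep
  exact ⟨fun j ↦ f^[j] ⟨1, one_pos⟩, fun j ↦ by simpa only [f.iterate_succ_apply'] using hf _⟩

section LimitSet

variable {E : ℕ → Set ℝ} {s C : ℝ} {n : ℕ → ℕ}

theorem strictMono_of_isAdmissible (h : ∀ j, IsAdmissible E s C (n j) (n (j + 1))) :
    StrictMono n :=
  strictMono_nat_of_lt_succ fun j ↦ by linarith [(h j).pos, (h j).two_mul_le]

theorem IsAdmissible.exists_embedding {a N : ℕ} (h : IsAdmissible E s C a N) (hC : 0 < C) (y : ℝ) :
    ∃ f : Fin ⌈(N : ℝ) ^ s / (2 * C * a)⌉₊ ↪ ℝ, ∀ j, f j ∈ E N ∩ Icc y (y + 1 / (2 * a)) := by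
  obtain ⟨F, hFE, hF⟩ := h.exists_finset y
  have ha : (0 : ℝ) < a := Nat.cast_pos.2 h.pos
  have hcard : ⌈(N : ℝ) ^ s / (2 * C * a)⌉₊ ≤ #F := Nat.ceil_le.2 <| by
    rw [div_le_iff₀ (by positivity)]
    rw [div_mul_eq_mul_div, one_mul, div_le_iff₀ (by positivity)] at hF
    linarith
  obtain ⟨f⟩ : Nonempty (Fin ⌈(N : ℝ) ^ s / (2 * C * a)⌉₊ ↪ F) :=
    Function.Embedding.nonempty_of_card_le (by simpa using hcard)
  exact ⟨f.trans (.subtype _), fun j ↦ hFE (f j).2⟩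

theorem exists_isBranching_of_isAdmissible (hC : 0 < C)
    (h : ∀ j, IsAdmissible E s C (n j) (n (j + 1))) :
    ∃ e : ∀ j, ℝ → Fin ⌈(n (j + 1) : ℝ) ^ s / (2 * C * n j)⌉₊ → ℝ,
      IsBranching e (fun j ↦ (n j : ℝ)⁻¹) (fun j ↦ (C * n (j + 1) ^ s)⁻¹) ∧
        ∀ j y i, e j y i ∈ E (n (j + 1)) := by
  have hpos (j : ℕ) : (0 : ℝ) < n j := Nat.cast_pos.2 (h j).pos
  choose e he using fun j y ↦ (h j).exists_embedding hC y
  refine ⟨fun j y ↦ e j y, ⟨fun j ↦ inv_pos.2 (hpos j), fun j y i ↦ (he j y i).2.1,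
    fun j y i ↦ ?_, fun j y y' i i' hne ↦ (h j).separated (he j y i).1 (he j y' i').1 hne,
    fun j y ↦ (e j y).injective, fun j ↦ ?_⟩, fun j y i ↦ (he j y i).1⟩
  · have hhalf : (n (j + 1) : ℝ)⁻¹ ≤ 1 / (2 * n j) := by
      rw [inv_eq_one_div]
      have := hpos j
      gcongr
      exact_mod_cast (h j).two_mul_le
    have hsum : 1 / (2 * n j) + 1 / (2 * n j) = (n j : ℝ)⁻¹ := by field_simp; norm_num
    linarith [(he j y i).2.2]
  · have := hpos (j + 1)
    rw [← div_eq_mul_inv, div_le_iff₀ this, inv_mul_eq_div, le_div_iff₀ (by positivity)]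
    exact (h j).three_mul_le

theorem IsBranching.branchLimit_mem_limitSet {m : ℕ → ℕ} {e : ∀ j, ℝ → Fin (m j) → ℝ} {d : ℕ → ℝ}
    (he : IsBranching e (fun j ↦ (n j : ℝ)⁻¹) d) (heE : ∀ j y i, e j y i ∈ E (n (j + 1)))
    (ω : ∀ j, Fin (m j)) : branchLimit e ω ∈ limitSet E n := by
  refine ⟨?_, mem_iInter.2 fun j ↦ ?_⟩
  · have hlim := he.branchLimit_mem_Icc ω 0
    simp only [branchPoint, zero_add] at hlim
    exact Icc_subset_Icc_right (n 0).cast_inv_le_one hlim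
  · have hlim := he.branchLimit_mem_Icc ω (j + 1)
    refine mem_cthickening_of_dist_le _ _ _ _ (heE j (branchPoint e ω j) (ω j)) ?_
    simp only [branchPoint, mem_Icc] at hlim
    rw [Real.dist_eq, abs_of_nonneg] <;> linarith

theorem eventually_prod_inv_le_rpow (hC : 0 < C) (h : ∀ j, IsAdmissible E s C (n j) (n (j + 1)))
    {m : ℕ → ℕ} (hm : ∀ j, (n (j + 1) : ℝ) ^ s / (2 * C * n j) ≤ m j) {t : ℝ} (hts : t < s) :
    ∀ᶠ k in atTop, ∏ i ∈ Finset.range k, (m i : ℝ)⁻¹ ≤ (n k : ℝ)⁻¹ ^ t := by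
  have hpos (j : ℕ) : (0 : ℝ) < n j := Nat.cast_pos.2 (h j).pos
  have hntop : Tendsto (fun j ↦ (n j : ℝ)) atTop atTop :=
    tendsto_natCast_atTop_atTop.comp (strictMono_of_isAdmissible h).tendsto_atTop
  rw [← map_add_atTop_eq_nat 1, eventually_map]
  filter_upwards [(hntop.const_div_atTop 1).eventually_le_const (sub_pos.2 hts)]
    with j hj
  have hN := hpos (j + 1)
  have ha := hpos j
  calc ∏ i ∈ Finset.range (j + 1), (m i : ℝ)⁻¹
      ≤ 1 * (m j : ℝ)⁻¹ := by
        rw [Finset.prod_range_succ]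
        gcongr
        exact Finset.prod_le_one (fun i _ ↦ by positivity) fun i _ ↦ (m i).cast_inv_le_one
    _ ≤ 2 * C * n j / (n (j + 1) : ℝ) ^ s := by
        rw [one_mul, ← inv_div]
        exact inv_anti₀ (by positivity) (hm j)
    _ ≤ (n (j + 1) : ℝ) ^ (1 / n j : ℝ) / (n (j + 1) : ℝ) ^ s := by
        gcongr
        exact (h j).two_mul_mul_le_rpow
    _ ≤ (n (j + 1) : ℝ) ^ (s - t) / (n (j + 1) : ℝ) ^ s := by
        gcongr
        exact Nat.one_le_cast.2 (h (j + 1)).pos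
    _ = (n (j + 1) : ℝ)⁻¹ ^ t := by
        rw [← Real.rpow_sub hN, sub_sub_cancel_left, Real.rpow_neg hN.le, Real.inv_rpow hN.le]

theorem le_dimH_limitSet (hC : 0 < C) (hs : s ≤ 1)
    (h : ∀ j, IsAdmissible E s C (n j) (n (j + 1))) {t : ℝ≥0} (hts : t < s) :
    t ≤ dimH (limitSet E n) := by
  have hpos (j : ℕ) : (0 : ℝ) < n j := Nat.cast_pos.2 (h j).pos
  have hm (j : ℕ) : (n (j + 1) : ℝ) ^ s / (2 * C * n j) ≤ _ := Nat.le_ceil _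
  have (j : ℕ) : NeZero ⌈(n (j + 1) : ℝ) ^ s / (2 * C * n j)⌉₊ :=
    ⟨(Nat.ceil_pos.2 (by have := hpos j; have := hpos (j + 1); positivity)).ne'⟩
  obtain ⟨e, he, heE⟩ := exists_isBranching_of_isAdmissible hC h
  refine he.le_dimH (K := 2 * C ^ 2) ?_ (fun j ↦ ?_) (by exact_mod_cast hts.le.trans hs)
    (eventually_prod_inv_le_rpow hC h hm hts) (he.branchLimit_mem_limitSet heE)
  · exact tendsto_inv_atTop_zero.comp
      (tendsto_natCast_atTop_atTop.comp (strictMono_of_isAdmissible h).tendsto_atTop)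
  · have := hpos j
    have := hpos (j + 1)
    calc (n j : ℝ)⁻¹ = 2 * C ^ 2 * ((n (j + 1) : ℝ) ^ s / (2 * C * n j) *
          (C * (n (j + 1) : ℝ) ^ s)⁻¹) := by field_simp
      _ ≤ 2 * C ^ 2 * (_ * (C * (n (j + 1) : ℝ) ^ s)⁻¹) := by gcongr; exact hm j

theorem coveredAtScales_limitSet (hC : 0 < C) (hs : 0 ≤ s)
    (h : ∀ j, IsAdmissible E s C (n j) (n (j + 1))) : CoveredAtScales n s (limitSet E n) := by
  refine coveredAtScales_of_separated (D := 2) (strictMono_of_isAdmissible h).tendsto_atTop hs hC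
    ((isBounded_Icc 0 1).subset inter_subset_left) ?_
  rw [← map_add_atTop_eq_nat 1, eventually_map]
  exact .of_forall fun j ↦
    ⟨E (n (j + 1)), (h j).separated, limitSet_subset_thickening (h (j + 1)).pos⟩

theorem dimH_limitSet (hC : 0 < C) (hs0 : 0 ≤ s) (hs1 : s ≤ 1)
    (h : ∀ j, IsAdmissible E s C (n j) (n (j + 1))) :
    dimH (limitSet E n) = ENNReal.ofReal s := by
  refine ((coveredAtScales_limitSet hC hs0 h).dimH_le
    (strictMono_of_isAdmissible h).tendsto_atTop hs0).antisymm (le_of_forall_lt fun u hu ↦ ?_)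
  obtain ⟨t, hut, hts⟩ := ENNReal.lt_iff_exists_nnreal_btwn.1 hu
  exact hut.trans_le <|
    le_dimH_limitSet hC hs1 h (Real.lt_toNNReal_iff_coe_lt.1 (ENNReal.coe_lt_coe.1 hts))

end LimitSet

/-! ### Fractions with restricted denominators -/

/-- The fractions whose denominator is a multiple `q * M` of `M` with `q ≤ Q`. -/
def fractions (M Q : ℕ) : Set ℝ :=
  {x | ∃ p : ℤ, ∃ q : ℕ, 0 < q ∧ q ≤ Q ∧ x = p / (q * M)}

theorem fractions_mul_one_subset {M Q q : ℕ} (hq : 0 < q) (hqQ : q ≤ Q) :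
    fractions (q * M) 1 ⊆ fractions M Q := by
  rintro _ ⟨p, k, hk, hk1, rfl⟩
  obtain rfl : k = 1 := by omega
  exact ⟨p, q, hq, hqQ, by push_cast; rw [one_mul]⟩

theorem pairwise_fractions {M : ℕ} (hM : 0 < M) (Q : ℕ) :
    (fractions M Q).Pairwise ((M * Q ^ 2 : ℝ)⁻¹ ≤ dist · ·) := by
  rintro _ ⟨p, q, hq, hqQ, rfl⟩ _ ⟨p', q', hq', hqQ', rfl⟩ hne
  have hsub : (p / (q * M) - p' / (q' * M) : ℝ) = (p * q' - p' * q : ℤ) / (M * (q * q')) := by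
    push_cast
    field_simp
  have hnum : p * q' - p' * q ≠ 0 := fun h0 ↦ hne <| sub_eq_zero.1 <| by
    rw [hsub, h0, Int.cast_zero, zero_div]
  have hnum' : (1 : ℝ) ≤ |((p * q' - p' * q : ℤ) : ℝ)| := by
    exact_mod_cast Int.one_le_abs hnum
  rw [Real.dist_eq, hsub, abs_div, abs_of_nonneg (by positivity : (0 : ℝ) ≤ M * (q * q')),
    inv_eq_one_div, sq]
  gcongr

theorem exists_dist_fractions_le {M Q : ℕ} (hM : 0 < M) (hQ : 0 < Q) (ξ : ℝ) :
    ∃ q, 0 < q ∧ q ≤ Q ∧ ∃ z ∈ fractions (q * M) 1, dist ξ z ≤ (Q * (q * M) : ℝ)⁻¹ := by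
  obtain ⟨q, hq, hqQ, hround⟩ := Real.exists_nat_abs_mul_sub_round_le (M * ξ) hQ
  have hqM : (0 : ℝ) < q * M := by positivity
  refine ⟨q, hq, hqQ, round (q * (M * ξ)) / (1 * (q * M : ℕ)),
    ⟨round (q * (M * ξ)), 1, one_pos, le_rfl, by rw [Nat.cast_one]⟩, ?_⟩
  have hdiff : ξ - round (q * (M * ξ)) / (1 * (q * M : ℕ)) =
      (q * (M * ξ) - round (q * (M * ξ))) / (q * M) := by
    push_cast
    field_simp
  rw [Real.dist_eq, hdiff, abs_div, abs_of_pos hqM, mul_inv, ← div_eq_mul_inv]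
  gcongr
  refine hround.trans ?_
  rw [inv_eq_one_div]
  gcongr
  linarith

theorem finite_and_ncard_fractions_inter_Icc_le {M Q : ℕ} (hM : 0 < M) (hQ : 0 < Q) (x : ℝ)
    {ℓ : ℝ} (hℓ : 0 ≤ ℓ) : (fractions M Q ∩ Icc x (x + ℓ)).Finite ∧
      ((fractions M Q ∩ Icc x (x + ℓ)).ncard : ℝ) ≤ 1 + ℓ * (M * Q ^ 2) := by
  obtain ⟨hfin, hcard⟩ := finite_and_ncard_le_of_pairwise_le_dist (by positivity)
    (le_add_of_nonneg_right hℓ) inter_subset_right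
    ((pairwise_fractions hM Q).mono (inter_subset_left (t := Icc x (x + ℓ))))
  exact ⟨hfin, by simpa [div_eq_mul_inv] using hcard⟩

theorem volume_biUnion_closedBall_le {F : Set ℝ} (hF : F.Finite) {r : ℝ} :
    volume (⋃ z ∈ F, closedBall z r) ≤ ENNReal.ofReal (F.ncard * (2 * r)) := by
  rw [ncard_eq_toFinset_card F hF, ENNReal.ofReal_mul (by positivity), ENNReal.ofReal_natCast]
  simpa using measure_biUnion_finset_le (μ := volume) hF.toFinset (closedBall · r)

theorem sum_inv_le_two_mul_sqrt (n : ℕ) : ∑ q ∈ Finset.Icc 1 n, (q : ℝ)⁻¹ ≤ 2 * √n := by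
  rcases n.eq_zero_or_pos with rfl | hn
  · simp
  calc ∑ q ∈ Finset.Icc 1 n, (q : ℝ)⁻¹ = harmonic n := by rw [harmonic_eq_sum_Icc]; push_cast; rfl
    _ ≤ 1 + 2 * Real.log √n := by
        rw [Real.log_sqrt n.cast_nonneg, mul_div_cancel₀ _ two_ne_zero]
        exact harmonic_le_one_add_log n
    _ ≤ 2 * √n := by linarith [Real.log_le_sub_one_of_pos (x := √n) (by positivity)]

section Counting

variable {M Q : ℕ} {x ℓ : ℝ}

theorem Icc_subset_biUnion_closedBall_fractions (hM : 0 < M) (hQ : 0 < Q)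
    (hℓ : 4 ≤ ℓ * (M * Q)) :
    Icc (x + ℓ / 4) (x + 3 * ℓ / 4) ⊆
      (⋃ q ∈ Finset.Icc 1 (Q / 16), ⋃ z ∈ fractions (q * M) 1 ∩ Icc x (x + ℓ),
        closedBall z (Q * (q * M) : ℝ)⁻¹) ∪
      ⋃ z ∈ fractions M Q ∩ Icc x (x + ℓ), closedBall z (16 / (M * Q ^ 2)) := by
  intro ξ hξ
  obtain ⟨q, hq, hqQ, z, hz, hξz⟩ := exists_dist_fractions_le hM hQ ξ
  have hq1 : (1 : ℝ) ≤ q := Nat.one_le_cast.2 hq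
  have hzI : z ∈ Icc x (x + ℓ) := by
    have hξz' : dist ξ z ≤ ℓ / 4 :=
      calc dist ξ z ≤ (Q * (q * M) : ℝ)⁻¹ := hξz
        _ ≤ (Q * (1 * M) : ℝ)⁻¹ := by gcongr
        _ ≤ ℓ / 4 := by
            rw [inv_eq_one_div, div_le_div_iff₀ (by positivity) (by positivity)]
            linarith
    rw [Real.dist_eq, abs_le] at hξz'
    constructor <;> linarith [hξ.1, hξ.2]
  rcases le_or_gt q (Q / 16) with hsmall | hlarge
  · exact .inl <| mem_iUnion₂.2
      ⟨q, Finset.mem_Icc.2 ⟨hq, hsmall⟩, mem_iUnion₂.2 ⟨z, ⟨hz, hzI⟩, hξz⟩⟩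
  · refine .inr <| mem_iUnion₂.2 ⟨z, ⟨fractions_mul_one_subset hq hqQ hz, hzI⟩, hξz.trans ?_⟩
    have hQq : (Q : ℝ) ≤ 16 * q := by exact_mod_cast (by omega : Q ≤ 16 * q)
    rw [inv_le_comm₀ (by positivity) (by positivity), inv_div, div_le_iff₀ (by positivity)]
    nlinarith [mul_le_mul_of_nonneg_left hQq (by positivity : (0 : ℝ) ≤ M * Q)]

theorem volume_biUnion_closedBall_fractions_le (hM : 0 < M) (hQ : 0 < Q)
    (hℓ : 32 ≤ ℓ * (M * √Q)) :
    volume (⋃ q ∈ Finset.Icc 1 (Q / 16), ⋃ z ∈ fractions (q * M) 1 ∩ Icc x (x + ℓ),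
      closedBall z (Q * (q * M) : ℝ)⁻¹) ≤ ENNReal.ofReal (ℓ / 4) := by
  have hℓ0 : 0 < ℓ := pos_of_mul_pos_left (by linarith : 0 < ℓ * (M * √Q)) (by positivity)
  have hQ' : (0 : ℝ) < Q := Nat.cast_pos.2 hQ
  have hgrid : ∀ q ∈ Finset.Icc 1 (Q / 16),
      volume (⋃ z ∈ fractions (q * M) 1 ∩ Icc x (x + ℓ), closedBall z (Q * (q * M) : ℝ)⁻¹) ≤
        ENNReal.ofReal (2 * ℓ / Q + 2 / (Q * M) * (q : ℝ)⁻¹) := fun q hq ↦ by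
    have hq : 0 < q := (Finset.mem_Icc.1 hq).1
    obtain ⟨hfin, hcard⟩ := finite_and_ncard_fractions_inter_Icc_le (mul_pos hq hM) one_pos x hℓ0.le
    refine (volume_biUnion_closedBall_le hfin).trans (ENNReal.ofReal_le_ofReal ?_)
    refine (mul_le_mul_of_nonneg_right hcard (by positivity)).trans_eq ?_
    push_cast
    field_simp
    ring
  refine (measure_biUnion_finset_le _ _).trans ((Finset.sum_le_sum hgrid).trans ?_)
  rw [← ENNReal.ofReal_sum_of_nonneg fun _ _ ↦ by positivity]
  refine ENNReal.ofReal_le_ofReal ?_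
  calc ∑ q ∈ Finset.Icc 1 (Q / 16), (2 * ℓ / Q + 2 / (Q * M) * (q : ℝ)⁻¹)
      = (Q / 16 : ℕ) * (2 * ℓ / Q) + 2 / (Q * M) * ∑ q ∈ Finset.Icc 1 (Q / 16), (q : ℝ)⁻¹ := by
        simp [Finset.sum_add_distrib, Finset.mul_sum]
    _ ≤ (Q / 16 : ℝ) * (2 * ℓ / Q) + 2 / (Q * M) * (2 * √Q) := by
        gcongr
        · exact Nat.cast_div_le
        · refine (sum_inv_le_two_mul_sqrt _).trans ?_
          gcongr
          exact Nat.div_le_self Q 16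
    _ = ℓ / 8 + 4 / (M * √Q) := by
        field_simp
        linear_combination 512 * Real.mul_self_sqrt hQ'.le
    _ ≤ ℓ / 4 := by
        have : 4 / (M * √Q) ≤ ℓ / 8 := by
          rw [div_le_iff₀ (by positivity)]
          linarith
        linarith

/-- By Dirichlet's theorem every `ξ` is close to some `p / (q * M)` with `q ≤ Q`. The `ξ` for which
`q ≤ Q / 16` form a set of small measure, so that the balls of radius `16 / (M * Q ^ 2)` around
`fractions M Q` cover most of the interval. -/
theorem le_ncard_fractions_inter_Icc (hM : 0 < M) (hQ : 0 < Q) (hℓ : 32 ≤ ℓ * (M * √Q)) :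
    ℓ * (M * Q ^ 2) ≤ 128 * (fractions M Q ∩ Icc x (x + ℓ)).ncard := by
  have hℓ0 : 0 < ℓ := pos_of_mul_pos_left (by linarith : 0 < ℓ * (M * √Q)) (by positivity)
  have hℓQ : 4 ≤ ℓ * (M * Q) := by
    have hsqrt : √Q ≤ Q :=
      Real.sqrt_le_iff.2 ⟨Q.cast_nonneg, by exact_mod_cast Nat.le_self_pow two_ne_zero Q⟩
    have : ℓ * (M * √Q) ≤ ℓ * (M * Q) := by gcongr
    linarith
  obtain ⟨hfin, -⟩ := finite_and_ncard_fractions_inter_Icc_le hM hQ x hℓ0.le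
  have hvol : ENNReal.ofReal (ℓ / 2) ≤ ENNReal.ofReal
      (ℓ / 4 + (fractions M Q ∩ Icc x (x + ℓ)).ncard * (2 * (16 / (M * Q ^ 2)))) :=
    calc ENNReal.ofReal (ℓ / 2) = volume (Icc (x + ℓ / 4) (x + 3 * ℓ / 4)) := by
          rw [Real.volume_Icc]; ring_nf
      _ ≤ _ := (measure_mono (Icc_subset_biUnion_closedBall_fractions hM hQ hℓQ)).trans
          (measure_union_le _ _)
      _ ≤ _ := by
          rw [ENNReal.ofReal_add (by positivity) (by positivity)]
          exact add_le_add (volume_biUnion_closedBall_fractions_le hM hQ hℓ)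
            (volume_biUnion_closedBall_le hfin)
  rw [ENNReal.ofReal_le_ofReal_iff (by positivity)] at hvol
  have hquarter : ℓ / 4 ≤ 32 * (fractions M Q ∩ Icc x (x + ℓ)).ncard / (M * Q ^ 2) := by
    linear_combination hvol
  rw [le_div_iff₀ (by positivity)] at hquarter
  linarith

end Counting

theorem isSpread_fractions {M Q : ℕ → ℕ} {s : ℝ}
    (hθ : (fun k ↦ (M k * Q k ^ 2 : ℝ)) =Θ[atTop] fun k : ℕ ↦ (k : ℝ) ^ s)
    (htop : Tendsto (fun k ↦ M k * √(Q k)) atTop atTop) :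
    ∃ C > 0, IsSpread (fun k ↦ fractions (M k) (Q k)) s C := by
  obtain ⟨C₁, hC₁, hle⟩ := hθ.isBigO.exists_pos
  obtain ⟨C₂, hC₂, hge⟩ := hθ.symm.isBigO.exists_pos
  have hpos : ∀ᶠ k in atTop, 0 < M k ∧ 0 < Q k := by
    filter_upwards [htop.eventually_gt_atTop 0] with k hk
    constructor <;> refine Nat.pos_of_ne_zero fun h0 ↦ ?_ <;> simp [h0] at hk
  refine ⟨C₁ + 128 * C₂, by positivity, ?_, fun ℓ hℓ ↦ ?_⟩
  · filter_upwards [hle.bound, hpos] with k hk ⟨hM, hQ⟩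
    refine (pairwise_fractions hM (Q k)).mono' fun x y hxy ↦ le_trans ?_ hxy
    rw [Real.norm_of_nonneg (by positivity), Real.norm_of_nonneg (by positivity)] at hk
    refine inv_anti₀ (by positivity) (hk.trans ?_)
    gcongr
    linarith
  · filter_upwards [hge.bound, hpos, htop.eventually_ge_atTop (32 / ℓ)] with k hk ⟨hM, hQ⟩ htop x
    rw [Real.norm_of_nonneg (by positivity), Real.norm_of_nonneg (by positivity)] at hk
    have hfin := (finite_and_ncard_fractions_inter_Icc_le hM hQ x hℓ.le).1
    refine ⟨hfin.toFinset, hfin.coe_toFinset.subset, ?_⟩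
    rw [← ncard_eq_toFinset_card _ hfin]
    calc ℓ * (k : ℝ) ^ s ≤ ℓ * (C₂ * (M k * Q k ^ 2)) := by gcongr
      _ = C₂ * (ℓ * (M k * Q k ^ 2)) := by ring
      _ ≤ C₂ * (128 * (fractions (M k) (Q k) ∩ Icc x (x + ℓ)).ncard) :=
          mul_le_mul_of_nonneg_left
            (le_ncard_fractions_inter_Icc hM hQ ((div_le_iff₀' hℓ).1 htop)) hC₂.le
      _ ≤ _ := by
          rw [← mul_assoc]
          gcongr
          linarith

theorem exists_add_mul_mem_fractions {M N Q : ℕ} (hM : 0 < M) (hN : 0 < N) {w : ℝ}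
    (hw : w ∈ fractions M Q) :
    ∃ q, 0 < q ∧ q ≤ Q ∧ ∀ u ∈ fractions (M * N) 1, ∀ v ∈ fractions N 1,
      u + w * v ∈ fractions (q * (M * N)) 1 := by
  obtain ⟨p, q, hq, hqQ, rfl⟩ := hw
  refine ⟨q, hq, hqQ, ?_⟩
  rintro _ ⟨p₁, k₁, hk₁, hk₁', rfl⟩ _ ⟨p₂, k₂, hk₂, hk₂', rfl⟩
  obtain rfl : k₁ = 1 := by omega
  obtain rfl : k₂ = 1 := by omega
  refine ⟨p₁ * q + p * p₂, 1, one_pos, le_rfl, ?_⟩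
  push_cast
  field_simp

theorem add_smul_subset_thickening {R : Type*} [SeminormedRing R] {A B E F G : Set R} {c w : R}
    {δ K L : ℝ} (hA : A ⊆ thickening δ E) (hB : B ⊆ thickening δ F) (hBK : ∀ b ∈ B, ‖b‖ ≤ K)
    (hcw : dist c w ≤ δ) (hw : ‖w‖ ≤ L) (hG : ∀ u ∈ E, ∀ v ∈ F, u + w * v ∈ G) :
    A + c • B ⊆ thickening ((1 + K + L) * δ) G := by
  rintro _ ⟨a, ha, _, ⟨b, hb, rfl⟩, rfl⟩
  obtain ⟨u, hu, hau⟩ := mem_thickening_iff.1 (hA ha)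
  obtain ⟨v, hv, hbv⟩ := mem_thickening_iff.1 (hB hb)
  refine mem_thickening_iff.2 ⟨u + w * v, hG u hu v hv, ?_⟩
  rw [dist_eq_norm] at hau hbv hcw ⊢
  have hL : 0 ≤ L := (norm_nonneg w).trans hw
  calc ‖a + c * b - (u + w * v)‖ = ‖(a - u) + ((c - w) * b + w * (b - v))‖ := by noncomm_ring
    _ ≤ ‖a - u‖ + (‖(c - w) * b‖ + ‖w * (b - v)‖) :=
        (norm_add_le _ _).trans (add_le_add_right (norm_add_le _ _) _)
    _ ≤ ‖a - u‖ + (δ * K + L * δ) := by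
        gcongr
        · exact (norm_mul_le _ _).trans
            (mul_le_mul hcw (hBK b hb) (norm_nonneg _) ((norm_nonneg _).trans hcw))
        · exact (norm_mul_le _ _).trans (mul_le_mul hw hbv.le (norm_nonneg _) hL)
    _ < (1 + K + L) * δ := by linarith

theorem coveredAtScales_add_smul_limitSet_fractions {M N Q n : ℕ → ℕ} {t c : ℝ}
    (hn : Tendsto n atTop atTop) (ht : 0 ≤ t) (hM : ∀ k, 0 < M k) (hN : ∀ k, 0 < N k)
    (hMNQ : (fun k ↦ (M k * N k * Q k : ℝ)) =O[atTop] fun k : ℕ ↦ (k : ℝ) ^ t)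
    (hc : c ∈ limitSet (fun k ↦ fractions (M k) (Q k)) n) :
    CoveredAtScales n t (limitSet (fun k ↦ fractions (M k * N k) 1) n +
      c • limitSet (fun k ↦ fractions (N k) 1) n) := by
  obtain ⟨K, hK, hMNQ⟩ := hMNQ.exists_pos
  have hbdd (E : ℕ → Set ℝ) : Bornology.IsBounded (limitSet E n) :=
    (isBounded_Icc 0 1).subset inter_subset_left
  have hnorm (E : ℕ → Set ℝ) : ∀ x ∈ limitSet E n, ‖x‖ ≤ 1 := fun x hx ↦ by
    rw [Real.norm_of_nonneg hx.1.1]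
    exact hx.1.2
  refine coveredAtScales_of_separated (D := 10) hn ht hK ((hbdd _).add ((hbdd _).smul₀ c)) ?_
  have hlarge := hn.eventually (hMNQ.bound.and (eventually_gt_atTop 0))
  rw [← map_add_atTop_eq_nat 1, eventually_map] at hlarge ⊢
  filter_upwards [hlarge] with j ⟨hk, hpos⟩
  set k := n (j + 1)
  obtain ⟨w, hw, hcw⟩ := mem_thickening_iff.1 (limitSet_subset_thickening hpos hc)
  obtain ⟨q, hq, hqQ, hG⟩ := exists_add_mul_mem_fractions (hM k) (hN k) hw
  refine ⟨fractions (q * (M k * N k)) 1, ?_, ?_⟩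
  · refine (pairwise_fractions (mul_pos hq (mul_pos (hM k) (hN k))) 1).mono' fun x y ↦ le_trans ?_
    have := hM k
    have := hN k
    rw [Real.norm_of_nonneg (by positivity), Real.norm_of_nonneg (by positivity)] at hk
    refine inv_anti₀ (by positivity) ?_
    calc ((q * (M k * N k) : ℕ) * (1 : ℕ) ^ 2 : ℝ) = M k * N k * q := by push_cast; ring
      _ ≤ M k * N k * Q k := by gcongr
      _ ≤ K * k ^ t := hk
  · have hk2 : (2 / k : ℝ) ≤ 2 := div_le_self zero_le_two (Nat.one_le_cast.2 hpos)
    have hwL : ‖w‖ ≤ 3 := by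
      linarith [norm_le_norm_add_norm_sub c w, dist_eq_norm c w, hnorm _ c hc]
    rw [show (10 / k : ℝ) = (1 + 1 + 3) * (2 / k) by ring]
    exact add_smul_subset_thickening
      (limitSet_subset_thickening (E := fun k ↦ fractions (M k * N k) 1) hpos)
      (limitSet_subset_thickening hpos) (hnorm _) hcw.le hwL hG

theorem tendsto_atTop_of_isTheta_rpow {M : ℕ → ℕ} {s : ℝ} (hs : 0 < s)
    (hθ : (fun k ↦ (M k : ℝ)) =Θ[atTop] fun k : ℕ ↦ (k : ℝ) ^ s) : Tendsto M atTop atTop := by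
  have hnorm : Tendsto (fun k ↦ ‖(M k : ℝ)‖) atTop atTop := hθ.tendsto_norm_atTop_iff.2 <|
    tendsto_norm_atTop_atTop.comp ((tendsto_rpow_atTop hs).comp tendsto_natCast_atTop_atTop)
  simpa only [Real.norm_natCast, tendsto_natCast_atTop_iff] using hnorm

theorem isSpread_fractions_one {M : ℕ → ℕ} {s : ℝ} (hs : 0 < s)
    (hθ : (fun k ↦ (M k : ℝ)) =Θ[atTop] fun k : ℕ ↦ (k : ℝ) ^ s) :
    ∃ C > 0, IsSpread (fun k ↦ fractions (M k) 1) s C := by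
  refine isSpread_fractions (by simpa using hθ) ?_
  simpa [tendsto_natCast_atTop_iff] using tendsto_atTop_of_isTheta_rpow hs hθ

theorem isTheta_mul_rpow {f g : ℕ → ℝ} {u v : ℝ} (hf : f =Θ[atTop] fun k : ℕ ↦ (k : ℝ) ^ u)
    (hg : g =Θ[atTop] fun k : ℕ ↦ (k : ℝ) ^ v) :
    (fun k ↦ f k * g k) =Θ[atTop] fun k : ℕ ↦ (k : ℝ) ^ (u + v) := by
  refine (hf.mul hg).trans_eventuallyEq ?_
  filter_upwards [eventually_gt_atTop 0] with k hk
  exact (Real.rpow_add (Nat.cast_pos.2 hk) u v).symm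

/-- An everywhere positive integer approximation to `k ^ u`. -/
noncomputable def natPow (u : ℝ) (k : ℕ) : ℕ :=
  ⌊(k : ℝ) ^ u⌋₊ + 1

theorem isTheta_natPow {u : ℝ} (hu : 0 ≤ u) :
    (fun k ↦ (natPow u k : ℝ)) =Θ[atTop] fun k : ℕ ↦ (k : ℝ) ^ u := by
  have hfloor (k : ℕ) : (natPow u k : ℝ) = ⌊(k : ℝ) ^ u⌋₊ + 1 := by simp only [natPow]; norm_cast
  refine ⟨.of_bound 2 ?_, .of_bound 1 (.of_forall fun k ↦ ?_)⟩
  · filter_upwards [eventually_ge_atTop 1] with k hk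
    have hone : 1 ≤ (k : ℝ) ^ u := Real.one_le_rpow (Nat.one_le_cast.2 hk) hu
    rw [Real.norm_of_nonneg (by positivity), Real.norm_of_nonneg (by positivity), hfloor]
    linarith [Nat.floor_le (zero_le_one.trans hone)]
  · rw [Real.norm_of_nonneg (by positivity), Real.norm_of_nonneg (by positivity), hfloor, one_mul]
    exact (Nat.lt_floor_add_one _).le

theorem isTheta_natPow_mul_natPow {u v : ℝ} (hu : 0 ≤ u) (hv : 0 ≤ v) :
    (fun k ↦ ((natPow u k * natPow v k : ℕ) : ℝ)) =Θ[atTop] fun k : ℕ ↦ (k : ℝ) ^ (u + v) := by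
  exact_mod_cast isTheta_mul_rpow (isTheta_natPow hu) (isTheta_natPow hv)

theorem isSpread_fractions_natPow {u v : ℝ} (hu : 0 ≤ u) (hv : 0 < v) :
    ∃ C > 0, IsSpread (fun k ↦ fractions (natPow u k) (natPow v k)) (u + 2 * v) C := by
  refine isSpread_fractions ?_ ?_
  · have hv2 := isTheta_mul_rpow (isTheta_natPow hv.le) (isTheta_natPow hv.le)
    simpa only [sq, two_mul] using isTheta_mul_rpow (isTheta_natPow hu) hv2
  · refine tendsto_atTop_mono (fun k ↦ ?_) <| Real.tendsto_sqrt_atTop.comp <|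
      tendsto_natCast_atTop_atTop.comp (tendsto_atTop_of_isTheta_rpow hv (isTheta_natPow hv.le))
    exact le_mul_of_one_le_left (Real.sqrt_nonneg _) (Nat.one_le_cast.2 (Nat.succ_pos _))

theorem dimH_add_smul_limitSet_natPow_le {n : ℕ → ℕ} {u v w c : ℝ} (hn : Tendsto n atTop atTop)
    (hu : 0 ≤ u) (hv : 0 ≤ v) (hw : 0 ≤ w)
    (hc : c ∈ limitSet (fun k ↦ fractions (natPow u k) (natPow v k)) n) :
    dimH (limitSet (fun k ↦ fractions (natPow u k * natPow w k) 1) n +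
      c • limitSet (fun k ↦ fractions (natPow w k) 1) n) ≤ ENNReal.ofReal (u + w + v) := by
  have hprod := isTheta_mul_rpow
    (isTheta_mul_rpow (isTheta_natPow hu) (isTheta_natPow hw)) (isTheta_natPow hv)
  exact (coveredAtScales_add_smul_limitSet_fractions hn (by positivity) (fun _ ↦ Nat.succ_pos _)
    (fun _ ↦ Nat.succ_pos _) hprod.isBigO hc).dimH_le hn (by positivity)

theorem theorem1p2 (sA sB sC : ℝ)
    (hA : sA ∈ Set.Ioo (0 : ℝ) 1) (hB : sB ∈ Set.Ioo (0 : ℝ) 1) (hC : sC ∈ Set.Ioo (0 : ℝ) 1)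
    (hCAB : sC > sA - sB) (hAB : sA - sB ≥ 0) :
    ∃ A B C : Set ℝ,
      MeasurableSet A ∧ MeasurableSet B ∧ MeasurableSet C ∧
      dimH A = ENNReal.ofReal sA ∧ dimH B = ENNReal.ofReal sB ∧ dimH C = ENNReal.ofReal sC ∧
      ∀ c ∈ C, dimH (A + c • B) ≤
        ENNReal.ofReal (min ((sA + sB + sC) / 2) (min (sA + sB) 1)) := by
  obtain ⟨u, rfl⟩ : ∃ u, sA = u + sB := ⟨sA - sB, by ring⟩
  rw [add_sub_cancel_right] at hCAB hAB
  obtain ⟨v, rfl⟩ : ∃ v, sC = u + 2 * v := ⟨(sC - u) / 2, by ring⟩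
  have hv : 0 < v := by linarith
  obtain ⟨CA, hCA, spreadA⟩ := isSpread_fractions_one hA.1 (isTheta_natPow_mul_natPow hAB hB.1.le)
  obtain ⟨CB, hCB, spreadB⟩ := isSpread_fractions_one hB.1 (isTheta_natPow hB.1.le)
  obtain ⟨CC, hCC, spreadC⟩ := isSpread_fractions_natPow hAB hv
  obtain ⟨n, hn⟩ := exists_seq_of_forall_eventually fun a ha ↦
    (spreadA.eventually_isAdmissible hA.2 ha).and <|
      (spreadB.eventually_isAdmissible hB.2 ha).and (spreadC.eventually_isAdmissible hC.2 ha)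
  simp only [forall_and] at hn
  obtain ⟨admA, admB, admC⟩ := hn
  have hntop := (strictMono_of_isAdmissible admA).tendsto_atTop
  have hmeas (E : ℕ → Set ℝ) : MeasurableSet (limitSet E n) := (isClosed_limitSet E n).measurableSet
  refine ⟨_, _, _, hmeas _, hmeas _, hmeas _, dimH_limitSet hCA hA.1.le hA.2.le admA,
    dimH_limitSet hCB hB.1.le hB.2.le admB, dimH_limitSet hCC hC.1.le hC.2.le admC,
    fun c hc ↦ dimH_real_le_ofReal_min ?_ ?_⟩
  · rw [show (u + sB + sB + (u + 2 * v)) / 2 = u + sB + v by ring]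
    exact dimH_add_smul_limitSet_natPow_le hntop hAB hv.le hB.1.le hc
  · exact (coveredAtScales_limitSet hCA hA.1.le admA).dimH_add_smul_le
      (coveredAtScales_limitSet hCB hB.1.le admB) hntop (add_nonneg hA.1.le hB.1.le) c
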